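/- **Theorem.** Let $d\ge 1$, $n\ge d+1$ and $k\in\{0,1,\dots,d\}$. Let $X_1,\dots,X_n$ be independent random points, uniformly distributed on the unit sphere $\mathbb S^d\subset\mathbb R^{d+1}$, and let $P^{-1}_{n,d+1}=\operatorname{conv}(X_1,\dots,X_n)\subset\mathbb R^{d+1}$. With $\rho$ the geodesic distance on $\mathbb S^d$, let $$C_{i,n}=\{z\in\mathbb S^d:\rho(X_i,z)\le\rho(X_j,z)\text{ for all }j\in\{1,\dots,n\}\},\qquad i\in\{1,\dots,n\},$$ be the spherical Voronoi cells of the points. Let $N$ be uniformly distributed on $\{1,\dots,n\}$ and independent of $(X_1,\dots,X_n)$, and for $v\in\mathbb S^d$ let $O_v$ be an orthogonal transformation of $\mathbb R^{d+1}$ with $O_v v=e:=(1,0,\dots,0)$ whose matrix elements are Borel functions of $v$. The typical Voronoi cell is $\mathscr V_{n,d}=O_{X_N}C_{N,n}$. For a polytope $P$, let $f_\ell(P)$ be the number of $\ell$-dimensional faces of $P$ ($P$ itself is a face of $P$). For a spherical polytope $P=C\cap\mathbb S^d$, where $C$ is a polyhedral convex cone, let $f_\ell(P)$ be the number of $\ell$-dimensional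 faces of $P$, which are by definition the intersections with $\mathbb S^d$ of the $(\ell+1)$-dimensional faces of $C$ (again $C$ itself included). Then $f_k(\mathscr V_{n,d})$ and $f_{d-k}(P^{-1}_{n,d+1})$ are integrable and $$\mathbb E f_k(\mathscr V_{n,d})=\frac{d-k+1}{n}\,\mathbb E f_{d-k}(P^{-1}_{n,d+1}).$$ -/

import Mathlib

open MeasureTheory ProbabilityTheory

namespace SphericalVoronoi

/-- The Euclidean space `ℝ^(d+1)`, with coordinates `x_0, …, x_d`. -/
abbrev Space (d : ℕ) : Type := EuclideanSpace ℝ (Fin (d + 1))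

/-- The unit sphere `𝕊^d ⊆ ℝ^(d+1)`. -/
abbrev Sphere (d : ℕ) : Type := Metric.sphere (0 : Space d) 1

/-- The north pole `e = (1, 0, …, 0)`. -/
noncomputable def northPole (d : ℕ) : Space d := EuclideanSpace.single 0 1

/-- The normalized spherical Lebesgue measure `σ_d` on `𝕊^d`. -/
noncomputable def sphereUniform (d : ℕ) : Measure (Sphere d) :=
  ((volume : Measure (Space d)).toSphere Set.univ)⁻¹ • (volume : Measure (Space d)).toSphere

/-- The geodesic distance `ρ` on `𝕊^d`: the angle between two unit vectors. -/
noncomputable def geodesicDist {d : ℕ} (x y : Sphere d) : ℝ :=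
  InnerProductGeometry.angle (x : Space d) (y : Space d)

/-- The Voronoi cell of the point `x i` in the configuration `x`, as a subset of `ℝ^(d+1)`
contained in `𝕊^d`. -/
def voronoiCell {d n : ℕ} (x : Fin n → Sphere d) (i : Fin n) : Set (Space d) :=
  (fun z : Sphere d => (z : Space d)) ''
    {z : Sphere d | ∀ j, geodesicDist (x i) z ≤ geodesicDist (x j) z}

/-- A family `v ↦ O_v` of orthogonal transformations of `ℝ^(d+1)` with `O_v v = e` whose matrix
elements are Borel functions of `v`. -/
structure IsPoleRotation {d : ℕ} (O : Sphere d → (Space d ≃ₗᵢ[ℝ] Space d)) : Prop where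
  map_self : ∀ v : Sphere d, O v (v : Space d) = northPole d
  measurable_entry : ∀ i j : Fin (d + 1),
    Measurable fun v : Sphere d => (O v (EuclideanSpace.single j 1)) i

/-- The cell with number `i`, moved by `O` so that its centre becomes the north pole.
The typical cell is obtained by taking random points `x` and a random number `i`. -/
def rotatedCell {d n : ℕ} (O : Sphere d → (Space d ≃ₗᵢ[ℝ] Space d))
    (x : Fin n → Sphere d) (i : Fin n) : Set (Space d) :=
  O (x i) '' voronoiCell x i

/-- The (nonempty) `k`-dimensional faces of a convex polyhedron `P`: its intersections with
supporting hyperplanes, and `P` itself. The dimension is that of the affine hull. -/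
def polyhedronFaces {d : ℕ} (P : Set (Space d)) (k : ℕ) : Set (Set (Space d)) :=
  {F | F.Nonempty ∧ IsExposed ℝ P F ∧ Module.finrank ℝ (affineSpan ℝ F).direction = k}

/-- The number `f_k(P)` of `k`-dimensional faces of a convex polyhedron `P`. -/
noncomputable def numFaces {d : ℕ} (P : Set (Space d)) (k : ℕ) : ℕ :=
  (polyhedronFaces P k).ncard

/-- The unique cone `C` (containing the origin) with `C ∩ 𝕊^d = P`, for `P ⊆ 𝕊^d`. -/
def coneOver {d : ℕ} (P : Set (Space d)) : Set (Space d) :=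
  {y | y = 0 ∨ ‖y‖⁻¹ • y ∈ P}

/-- The `k`-dimensional faces of a spherical polytope `P = C ∩ 𝕊^d`: the intersections with
`𝕊^d` of the `(k+1)`-dimensional faces of the polyhedral cone `C`. -/
def sphericalFaces {d : ℕ} (P : Set (Space d)) (k : ℕ) : Set (Set (Space d)) :=
  (fun F => F ∩ Metric.sphere (0 : Space d) 1) '' polyhedronFaces (coneOver P) (k + 1)

/-- The number `f_k(P)` of `k`-dimensional faces of a spherical polytope `P`. -/
noncomputable def numSphericalFaces {d : ℕ} (P : Set (Space d)) (k : ℕ) : ℕ :=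
  (sphericalFaces P k).ncard

/-- The convex hull of the points `x i` in `ℝ^(d+1)`. -/
def pointHull {d n : ℕ} (x : Fin n → Sphere d) : Set (Space d) :=
  convexHull ℝ (Set.range fun i => (x i : Space d))

end SphericalVoronoi

/-! For unit vectors, `z` is nearest to `X_i` exactly when `⟨z, X_j⟩` is largest at `j = i`. So the
cone over the Voronoi cell of `X_i` is the normal cone of the hull at `X_i`
(`coneOver_voronoiCell`). Faces on both sides are encoded by the same index sets, those satisfying
`IsFaceSet`: faces of the hull by all nonempty `S`, faces of the normal cone at `X_i` by those `S`
containing `i`, and the two dimensions attached to `S` add up to `d + 1`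
(`polyhedronFaces_convexHull_range`, `polyhedronFaces_normalCone`). The full index set gives the
hull itself and the lineality space of the cone; this pair is needed when `n = d + 1` and `k = 0`.

Almost surely the points are in general position (`ae_inGeneralPosition`), so a face of dimension `d
- k` has `d - k + 1` vertices. Hence the cells together have `d - k + 1` times as many `k`-faces as
the hull has `(d - k)`-faces (`sum_sum_mem_and_isFaceSet`), and the independent uniform index
contributes the factor `1 / n`. -/

namespace SphericalVoronoi

/-! ### Duality between faces of a convex hull and faces of its normal cones. -/

section FaceLattice

variable {ι E : Type*} [NormedAddCommGroup E] [InnerProductSpace ℝ E]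

/-- `S` is the set of all indices whose points lie on some supporting hyperplane of the
configuration `x`. The zero functional is allowed, so the set of all indices qualifies. -/
def IsFaceSet (x : ι → E) (S : Finset ι) : Prop :=
  ∃ (u : E) (c : ℝ), (∀ i ∈ S, inner ℝ u (x i) = c) ∧ ∀ j ∉ S, inner ℝ u (x j) < c

/-- The normal cone at `x i` of the convex hull of the configuration `x`. -/
def normalCone (x : ι → E) (i : ι) : Set E :=
  {y | ∀ j, inner ℝ y (x j) ≤ inner ℝ y (x i)}

/-- The part of the normal cone at `x i` on which the constraints indexed by `S` are tight. -/
def normalConeFace (x : ι → E) (i : ι) (S : Finset ι) : Set E :=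
  {y ∈ normalCone x i | ∀ j ∈ S, inner ℝ y (x j) = inner ℝ y (x i)}

lemma IsFaceSet.exists_tight {x : ι → E} {S : Finset ι} (h : IsFaceSet x S) {i : ι}
    (hi : i ∈ S) : ∃ u : E, (∀ j ∈ S, inner ℝ u (x j) = inner ℝ u (x i)) ∧
      ∀ j ∉ S, inner ℝ u (x j) < inner ℝ u (x i) := by
  obtain ⟨u, c, h1, h2⟩ := h
  exact ⟨u, by rw [h1 i hi]; exact h1, by rw [h1 i hi]; exact h2⟩

lemma mem_normalConeFace_of_tight {x : ι → E} {S : Finset ι} {i : ι} {u : E}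
    (h1 : ∀ j ∈ S, inner ℝ u (x j) = inner ℝ u (x i))
    (h2 : ∀ j ∉ S, inner ℝ u (x j) < inner ℝ u (x i)) : u ∈ normalConeFace x i S := by
  classical
  refine ⟨fun j => ?_, h1⟩
  by_cases hj : j ∈ S
  · exact (h1 j hj).le
  · exact (h2 j hj).le

lemma zero_mem_normalCone (x : ι → E) (i : ι) : (0 : E) ∈ normalCone x i := by
  simp [normalCone]

lemma smul_mem_normalCone {x : ι → E} {i : ι} {y : E} (hy : y ∈ normalCone x i) {t : ℝ}
    (ht : 0 ≤ t) : t • y ∈ normalCone x i := by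
  intro j
  simp only [inner_smul_left, RCLike.conj_to_real]
  exact mul_le_mul_of_nonneg_left (hy j) ht

lemma zero_mem_normalConeFace (x : ι → E) (i : ι) (S : Finset ι) :
    (0 : E) ∈ normalConeFace x i S :=
  ⟨zero_mem_normalCone x i, by simp⟩

/-- Finitely many strict inequalities survive a small perturbation of `u` in any direction. -/
lemma exists_pos_add_smul_strict [Finite ι] {x : ι → E} {S : Finset ι} {i : ι} {u : E}
    (h : ∀ j ∉ S, inner ℝ u (x j) < inner ℝ u (x i)) (v : E) :
    ∃ ε : ℝ, 0 < ε ∧ ∀ j ∉ S, inner ℝ (u + ε • v) (x j) < inner ℝ (u + ε • v) (x i) := by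
  have key : ∀ᶠ ε in nhds (0 : ℝ), ∀ j, j ∉ S →
      inner ℝ (u + ε • v) (x j) < inner ℝ (u + ε • v) (x i) := by
    rw [Filter.eventually_all]
    intro j
    by_cases hj : j ∈ S
    · simp [hj]
    · have hc : ∀ k, Continuous fun ε : ℝ => inner ℝ (u + ε • v) (x k) := fun k => by fun_prop
      have : ∀ᶠ ε in nhds (0 : ℝ), inner ℝ (u + ε • v) (x j) < inner ℝ (u + ε • v) (x i) :=
        (hc j).continuousAt.eventually_lt (hc i).continuousAt (by simpa using h j hj)
      exact this.mono fun ε hε _ => hε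
  obtain ⟨ε, h1, h2⟩ :=
    ((key.filter_mono nhdsWithin_le_nhds).and (self_mem_nhdsWithin (s := Set.Ioi 0))).exists
  exact ⟨ε, h2, h1⟩

/-- The functional `u` witnessing `IsFaceSet` is a relative interior point: it can move within the
face along every `v` orthogonal to the span of the points of `S`. -/
lemma vectorSpan_normalConeFace [Finite ι] {x : ι → E} {S : Finset ι} {i : ι} (hi : i ∈ S)
    (h : IsFaceSet x S) :
    vectorSpan ℝ (normalConeFace x i S) = (vectorSpan ℝ (x '' (S : Set ι)))ᗮ := by
  apply le_antisymm
  · have hmem : ∀ y ∈ normalConeFace x i S, y ∈ (vectorSpan ℝ (x '' (S : Set ι)))ᗮ := by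
      intro y hy
      have : vectorSpan ℝ (x '' (S : Set ι)) ≤ (Submodule.span ℝ {y})ᗮ := by
        refine Submodule.span_le.2 ?_
        rintro _ ⟨_, ⟨j, hj, rfl⟩, _, ⟨k, hk, rfl⟩, rfl⟩
        simp only [vsub_eq_sub, SetLike.mem_coe]
        rw [Submodule.mem_orthogonal_singleton_iff_inner_right, inner_sub_right,
          hy.2 j hj, hy.2 k hk, sub_self]
      rw [Submodule.mem_orthogonal']
      intro w hw
      exact Submodule.mem_orthogonal_singleton_iff_inner_right.1 (this hw)
    refine Submodule.span_le.2 ?_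
    rintro _ ⟨y, hy, z, hz, rfl⟩
    exact Submodule.sub_mem _ (hmem y hy) (hmem z hz)
  · intro v hv
    obtain ⟨u, h1, h2⟩ := h.exists_tight hi
    obtain ⟨ε, hε, h3⟩ := exists_pos_add_smul_strict h2 v
    have hvj : ∀ j ∈ S, inner ℝ v (x j) = inner ℝ v (x i) := by
      intro j hj
      rw [← sub_eq_zero, ← inner_sub_right]
      exact (Submodule.mem_orthogonal' _ _).1 hv _
        (vsub_mem_vectorSpan ℝ (Set.mem_image_of_mem x hj) (Set.mem_image_of_mem x hi))
    have h4 : u + ε • v ∈ normalConeFace x i S := by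
      refine mem_normalConeFace_of_tight (fun j hj => ?_) h3
      simp only [inner_add_left, inner_smul_left, h1 j hj, hvj j hj]
    have h5 : u ∈ normalConeFace x i S := mem_normalConeFace_of_tight h1 h2
    have h6 := vsub_mem_vectorSpan ℝ h4 h5
    have h7 : v = ε⁻¹ • ((u + ε • v) -ᵥ u) := by
      rw [vsub_eq_sub, add_sub_cancel_left, smul_smul, inv_mul_cancel₀ hε.ne', one_smul]
    rw [h7]
    exact Submodule.smul_mem _ _ h6

/-- The witness for `T` lies in the face and is tight only on `T`, so the face determines the index
set. -/
lemma normalConeFace_injOn (x : ι → E) (i : ι) :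
    Set.InjOn (normalConeFace x i) {S | i ∈ S ∧ IsFaceSet x S} := by
  have key : ∀ S T : Finset ι, i ∈ T → IsFaceSet x T →
      normalConeFace x i S = normalConeFace x i T → S ⊆ T := by
    intro S T hi hT h j hj
    obtain ⟨u, h1, h2⟩ := hT.exists_tight hi
    have hu : u ∈ normalConeFace x i S := h ▸ mem_normalConeFace_of_tight h1 h2
    by_contra hjT
    exact (h2 j hjT).ne (hu.2 j hj)
  intro S hS T hT h
  exact (key S T hT.1 hT.2 h).antisymm (key T S hS.1 hS.2 h.symm)

/-- The sum of the constraints in `S` is nonpositive on the cone and vanishes only where each of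
them is tight. -/
lemma isExposed_normalConeFace (x : ι → E) (i : ι) (S : Finset ι) :
    IsExposed ℝ (normalCone x i) (normalConeFace x i S) := by
  intro _
  refine ⟨innerSL ℝ (∑ j ∈ S, (x j - x i)), ?_⟩
  have hl : ∀ y, innerSL ℝ (∑ j ∈ S, (x j - x i)) y =
      ∑ j ∈ S, (inner ℝ y (x j) - inner ℝ y (x i)) := by
    intro y
    rw [innerSL_apply_apply, real_inner_comm, inner_sum]
    simp only [inner_sub_right]
  have hle : ∀ y ∈ normalCone x i, ∀ j ∈ S, inner ℝ y (x j) - inner ℝ y (x i) ≤ 0 :=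
    fun y hy j _ => sub_nonpos.2 (hy j)
  ext y
  constructor
  · rintro ⟨hy, hS⟩
    refine ⟨hy, fun z hz => ?_⟩
    rw [hl y, Finset.sum_eq_zero (fun j hj => sub_eq_zero.2 (hS j hj)), hl]
    exact Finset.sum_nonpos (hle z hz)
  · rintro ⟨hy, hmax⟩
    refine ⟨hy, fun j hj => ?_⟩
    have h0 := hmax 0 (zero_mem_normalCone x i)
    rw [map_zero, hl] at h0
    have h1 := (Finset.sum_eq_zero_iff_of_nonpos (hle y hy)).1
      (le_antisymm (Finset.sum_nonpos (hle y hy)) h0) j hj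
    exact sub_eq_zero.1 h1

/-- Take for `S` the constraints tight on all of `F`. -/
lemma exists_normalConeFace_eq [Fintype ι] {x : ι → E} {i : ι} {F : Set E} (hF : F.Nonempty)
    (hexp : IsExposed ℝ (normalCone x i) F) :
    ∃ S : Finset ι, i ∈ S ∧ IsFaceSet x S ∧ normalConeFace x i S = F := by
  classical
  obtain ⟨l, hl⟩ := hexp hF
  have hmem : ∀ y, y ∈ F ↔ y ∈ normalCone x i ∧ ∀ z ∈ normalCone x i, l z ≤ l y := by
    intro y; rw [hl]; rfl
  have hzero : ∀ y ∈ F, l y = 0 := by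
    intro y hy
    obtain ⟨hy1, hy2⟩ := (hmem y).1 hy
    -- Comparison with `0` and `2 • y`, both in the cone, forces the maximum to be `0`.
    have h1 := hy2 0 (zero_mem_normalCone x i)
    have h2 := hy2 _ (smul_mem_normalCone hy1 (t := 2) (by norm_num))
    rw [map_zero] at h1
    rw [map_smul, smul_eq_mul] at h2
    linarith
  obtain ⟨y₀, hy₀⟩ := hF
  have hnonpos : ∀ z ∈ normalCone x i, l z ≤ 0 := fun z hz =>
    (((hmem y₀).1 hy₀).2 z hz).trans_eq (hzero y₀ hy₀)
  let S : Finset ι := Finset.univ.filter fun j => ∀ y ∈ F, inner ℝ y (x j) = inner ℝ y (x i)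
  have hS : ∀ j, j ∈ S ↔ ∀ y ∈ F, inner ℝ y (x j) = inner ℝ y (x i) := by
    intro j; simp [S]
  have hex : ∀ j, ∃ y ∈ F, j ∉ S → inner ℝ y (x j) < inner ℝ y (x i) := by
    intro j
    by_cases hj : j ∈ S
    · exact ⟨y₀, hy₀, fun h => absurd hj h⟩
    · have hj' := hj
      rw [hS] at hj'
      push Not at hj'
      obtain ⟨y, hy, hne⟩ := hj'
      exact ⟨y, hy, fun _ => lt_of_le_of_ne (((hmem y).1 hy).1 j) hne⟩
  choose y hyF hy using hex
  -- Each `j ∉ S` is strict at some `y j ∈ F`, so the sum is strict at all of them at once.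
  let u : E := ∑ j, y j
  have hu1 : ∀ j ∈ S, inner ℝ u (x j) = inner ℝ u (x i) := by
    intro j hj
    simp only [u, sum_inner]
    exact Finset.sum_congr rfl fun k _ => (hS j).1 hj _ (hyF k)
  have hu2 : ∀ j ∉ S, inner ℝ u (x j) < inner ℝ u (x i) := by
    intro j hj
    simp only [u, sum_inner]
    exact Finset.sum_lt_sum (fun k _ => ((hmem _).1 (hyF k)).1 j)
      ⟨j, Finset.mem_univ j, hy j hj⟩
  have hlu : l u = 0 := by
    simp only [u, map_sum]
    exact Finset.sum_eq_zero fun j _ => hzero _ (hyF j)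
  refine ⟨S, (hS i).2 fun _ _ => rfl, ⟨u, _, hu1, hu2⟩, ?_⟩
  ext z
  constructor
  · rintro ⟨hz, hzS⟩
    -- Stepping from `u` away from `z` stays in the cone; as `l u = 0` and `l ≤ 0` there, `l z ≥ 0`.
    obtain ⟨ε, hε, h3⟩ := exists_pos_add_smul_strict hu2 (-z)
    have h4 : u + ε • -z ∈ normalCone x i := by
      refine (mem_normalConeFace_of_tight (S := S) (fun j hj => ?_) h3).1
      simp only [inner_add_left, inner_smul_left, inner_neg_left, hu1 j hj, hzS j hj]
    have h5 := hnonpos _ h4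
    rw [map_add, hlu, map_smul, map_neg, smul_eq_mul] at h5
    have h6 : 0 ≤ l z := by
      have : 0 ≤ ε * l z := by linarith
      exact nonneg_of_mul_nonneg_right this hε
    exact (hmem z).2 ⟨hz, fun w hw => (hnonpos w hw).trans h6⟩
  · intro hz
    exact ⟨((hmem z).1 hz).1, fun j hj => (hS j).1 hj z hz⟩

/-- In a convex combination reaching the value `c`, the weighted gaps `c - ⟨u, x i⟩` sum to zero, so
every weight off `S` vanishes. -/
lemma convexHull_image_eq_of_supporting [Fintype ι] {x : ι → E} {S : Finset ι} {u : E} {c : ℝ}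
    (h1 : ∀ i ∈ S, inner ℝ u (x i) = c) (h2 : ∀ j ∉ S, inner ℝ u (x j) < c) :
    convexHull ℝ (x '' (S : Set ι)) = {y ∈ convexHull ℝ (Set.range x) | inner ℝ u y = c} := by
  classical
  apply Set.Subset.antisymm
  · intro y hy
    refine ⟨convexHull_mono (Set.image_subset_range _ _) hy, ?_⟩
    have hconv : Convex ℝ {y : E | innerSL ℝ u y = c} :=
      convex_hyperplane (innerSL ℝ u).toLinearMap.isLinear c
    refine convexHull_min ?_ hconv hy
    rintro _ ⟨i, hi, rfl⟩
    exact h1 i hi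
  · rintro y ⟨hy, hyc⟩
    rw [convexHull_range_eq_exists_affineCombination] at hy
    obtain ⟨s, w, hw0, hw1, rfl⟩ := hy
    rw [Finset.affineCombination_eq_linear_combination _ _ _ hw1] at hyc ⊢
    have hle : ∀ i, inner ℝ u (x i) ≤ c := fun i => by
      by_cases hi : i ∈ S
      · exact (h1 i hi).le
      · exact (h2 i hi).le
    have hsum : ∑ i ∈ s, w i * (c - inner ℝ u (x i)) = 0 := by
      simp only [mul_sub, Finset.sum_sub_distrib, ← Finset.sum_mul, hw1, one_mul]
      rw [← hyc, inner_sum]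
      simp [inner_smul_right]
    have hw : ∀ i ∈ s, i ∉ S → w i = 0 := by
      intro i hi hiS
      have := (Finset.sum_eq_zero_iff_of_nonneg (fun i hi =>
        mul_nonneg (hw0 i hi) (sub_nonneg.2 (hle i)))).1 hsum i hi
      exact (mul_eq_zero.1 this).resolve_right (sub_pos.2 (h2 i hiS)).ne'
    have hsub : s.filter (· ∈ S) ⊆ s := Finset.filter_subset _ _
    have hz : ∀ i ∈ s, i ∉ s.filter (· ∈ S) → w i = 0 := fun i hi hn =>
      hw i hi fun hiS => hn (Finset.mem_filter.2 ⟨hi, hiS⟩)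
    rw [← Finset.sum_subset hsub fun i hi hn => by rw [hz i hi hn, zero_smul]]
    rw [← Finset.sum_subset hsub hz] at hw1
    refine (convex_convexHull ℝ _).sum_mem (fun i hi => hw0 i (hsub hi)) hw1 fun i hi => ?_
    exact subset_convexHull ℝ _ (Set.mem_image_of_mem x (Finset.mem_filter.1 hi).2)

lemma convexHull_image_injOn [Fintype ι] (x : ι → E) :
    Set.InjOn (fun S : Finset ι => convexHull ℝ (x '' (S : Set ι))) {S | IsFaceSet x S} := by
  have key : ∀ S T : Finset ι, IsFaceSet x T →
      convexHull ℝ (x '' (S : Set ι)) = convexHull ℝ (x '' (T : Set ι)) → S ⊆ T := by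
    rintro S T ⟨u, c, h1, h2⟩ h j hj
    have hj' : x j ∈ convexHull ℝ (x '' (T : Set ι)) :=
      h ▸ subset_convexHull ℝ _ (Set.mem_image_of_mem x hj)
    rw [convexHull_image_eq_of_supporting h1 h2] at hj'
    by_contra hjT
    exact (h2 j hjT).ne hj'.2
  intro S hS T hT h
  exact (key S T hT h).antisymm (key T S hS h.symm)

lemma IsFaceSet.isExposed [Fintype ι] {x : ι → E} {S : Finset ι} (h : IsFaceSet x S)
    (hS : S.Nonempty) :
    IsExposed ℝ (convexHull ℝ (Set.range x)) (convexHull ℝ (x '' (S : Set ι))) := by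
  classical
  obtain ⟨u, c, h1, h2⟩ := h
  obtain ⟨i, hi⟩ := hS
  intro _
  refine ⟨innerSL ℝ u, ?_⟩
  have hle : ∀ y ∈ convexHull ℝ (Set.range x), innerSL ℝ u y ≤ c := by
    intro y hy
    refine convexHull_min ?_ (convex_halfSpace_le (innerSL ℝ u).toLinearMap.isLinear c) hy
    rintro _ ⟨j, rfl⟩
    by_cases hj : j ∈ S
    · exact (h1 j hj).le
    · exact (h2 j hj).le
  rw [convexHull_image_eq_of_supporting h1 h2]
  ext y
  constructor
  · rintro ⟨hy, hyc⟩
    exact ⟨hy, fun z hz => (hle z hz).trans_eq hyc.symm⟩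
  · rintro ⟨hy, hmax⟩
    refine ⟨hy, le_antisymm (hle y hy) ?_⟩
    have := hmax (x i) (subset_convexHull ℝ _ (Set.mem_range_self i))
    rwa [innerSL_apply_apply, h1 i hi] at this

lemma exists_convexHull_image_eq [Fintype ι] [CompleteSpace E] {x : ι → E} {F : Set E}
    (hF : F.Nonempty) (hexp : IsExposed ℝ (convexHull ℝ (Set.range x)) F) :
    ∃ S : Finset ι, S.Nonempty ∧ IsFaceSet x S ∧ convexHull ℝ (x '' (S : Set ι)) = F := by
  classical
  obtain ⟨l, hl⟩ := hexp hF
  obtain ⟨u, rfl⟩ := (InnerProductSpace.toDual ℝ E).surjective l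
  simp only [InnerProductSpace.toDual_apply_apply] at hl
  obtain ⟨y₀, hy₀⟩ := hF
  let c : ℝ := inner ℝ u y₀
  have hy₀' := hl ▸ hy₀
  have hle : ∀ z ∈ convexHull ℝ (Set.range x), inner ℝ u z ≤ c := hy₀'.2
  have hF : F = {y ∈ convexHull ℝ (Set.range x) | inner ℝ u y = c} := by
    rw [hl]
    ext y
    constructor
    · rintro ⟨hy, hmax⟩
      exact ⟨hy, le_antisymm (hle y hy) (hmax y₀ hy₀'.1)⟩
    · rintro ⟨hy, hyc⟩
      exact ⟨hy, fun z hz => (hle z hz).trans_eq hyc.symm⟩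
  let S : Finset ι := Finset.univ.filter fun i => inner ℝ u (x i) = c
  have h1 : ∀ i ∈ S, inner ℝ u (x i) = c := fun i hi => (Finset.mem_filter.1 hi).2
  have h2 : ∀ i ∉ S, inner ℝ u (x i) < c := fun i hi =>
    lt_of_le_of_ne (hle _ (subset_convexHull ℝ _ (Set.mem_range_self i)))
      fun h => hi (Finset.mem_filter.2 ⟨Finset.mem_univ i, h⟩)
  have hSF : convexHull ℝ (x '' (S : Set ι)) = F := by
    rw [hF, convexHull_image_eq_of_supporting h1 h2]
  refine ⟨S, ?_, ⟨u, c, h1, h2⟩, hSF⟩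
  have : (convexHull ℝ (x '' (S : Set ι))).Nonempty := hSF ▸ ⟨y₀, hy₀⟩
  simpa using this

end FaceLattice

/-! ### Face numbers as counts of index sets. -/

section Counting

variable {d n : ℕ}

/-- General position: any `d + 2` of the points are affinely independent. -/
def InGeneralPosition (x : Fin n → Space d) : Prop :=
  ∀ S : Finset (Fin n), S.card ≤ d + 2 → AffineIndependent ℝ fun i : S => x i

lemma polyhedronFaces_convexHull_range (x : Fin n → Space d) (m : ℕ) :
    polyhedronFaces (convexHull ℝ (Set.range x)) m =
      (fun S : Finset (Fin n) => convexHull ℝ (x '' (S : Set (Fin n)))) ''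
        {S | S.Nonempty ∧ IsFaceSet x S ∧
          Module.finrank ℝ (vectorSpan ℝ (x '' (S : Set (Fin n)))) = m} := by
  have hdim : ∀ S : Finset (Fin n),
      (affineSpan ℝ (convexHull ℝ (x '' (S : Set (Fin n))))).direction =
        vectorSpan ℝ (x '' (S : Set (Fin n))) := fun S => by
    rw [affineSpan_convexHull, direction_affineSpan]
  ext F
  constructor
  · rintro ⟨hF, hexp, hm⟩
    obtain ⟨S, hS, hface, rfl⟩ := exists_convexHull_image_eq hF hexp
    rw [hdim] at hm
    exact ⟨S, ⟨hS, hface, hm⟩, rfl⟩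
  · rintro ⟨S, ⟨hS, hface, hm⟩, rfl⟩
    refine ⟨by simpa using hS, hface.isExposed hS, ?_⟩
    rw [hdim, hm]

lemma polyhedronFaces_normalCone (x : Fin n → Space d) (i : Fin n) {m k : ℕ}
    (hmk : m + k = d + 1) :
    polyhedronFaces (normalCone x i) k = normalConeFace x i ''
        {S | i ∈ S ∧ IsFaceSet x S ∧
          Module.finrank ℝ (vectorSpan ℝ (x '' (S : Set (Fin n)))) = m} := by
  have hdim : ∀ S : Finset (Fin n), i ∈ S → IsFaceSet x S →
      (Module.finrank ℝ (affineSpan ℝ (normalConeFace x i S)).direction = k ↔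
        Module.finrank ℝ (vectorSpan ℝ (x '' (S : Set (Fin n)))) = m) := fun S hi hS => by
    rw [direction_affineSpan, vectorSpan_normalConeFace hi hS]
    have := Submodule.finrank_add_finrank_orthogonal (vectorSpan ℝ (x '' (S : Set (Fin n))))
    rw [finrank_euclideanSpace_fin] at this
    omega
  ext F
  constructor
  · rintro ⟨hF, hexp, hm⟩
    obtain ⟨S, hS, hface, rfl⟩ := exists_normalConeFace_eq hF hexp
    exact ⟨S, ⟨hS, hface, (hdim S hS hface).1 hm⟩, rfl⟩
  · rintro ⟨S, ⟨hS, hface, hm⟩, rfl⟩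
    exact ⟨⟨0, zero_mem_normalConeFace x i S⟩, isExposed_normalConeFace x i S,
      (hdim S hS hface).2 hm⟩

lemma mem_normalCone_inv_norm_smul {x : Fin n → Space d} {i : Fin n} {y : Space d} (hy : y ≠ 0) :
    ‖y‖⁻¹ • y ∈ normalCone x i ↔ y ∈ normalCone x i := by
  refine ⟨fun h => ?_, fun h => smul_mem_normalCone h (by positivity)⟩
  have := smul_mem_normalCone h (norm_nonneg y)
  rwa [smul_smul, mul_inv_cancel₀ (norm_ne_zero_iff.2 hy), one_smul] at this

lemma smul_mem_normalConeFace {x : Fin n → Space d} {i : Fin n} {S : Finset (Fin n)}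
    {y : Space d} (hy : y ∈ normalConeFace x i S) {t : ℝ} (ht : 0 ≤ t) :
    t • y ∈ normalConeFace x i S := by
  refine ⟨smul_mem_normalCone hy.1 ht, fun j hj => ?_⟩
  simp only [inner_smul_left, hy.2 j hj]

lemma geodesicDist_le_iff (x y z : Sphere d) :
    geodesicDist x z ≤ geodesicDist y z ↔
      inner ℝ (z : Space d) (y : Space d) ≤ inner ℝ (z : Space d) (x : Space d) := by
  have hn : ∀ w : Sphere d, ‖(w : Space d)‖ = 1 := fun w => mem_sphere_zero_iff_norm.1 w.2
  have hmem : ∀ w : Sphere d, inner ℝ (w : Space d) (z : Space d) ∈ Set.Icc (-1 : ℝ) 1 := by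
    intro w
    have h := abs_real_inner_le_norm (w : Space d) (z : Space d)
    rw [hn, hn, one_mul] at h
    exact abs_le.1 h
  simp only [geodesicDist, InnerProductGeometry.angle, hn, mul_one, div_one]
  rw [Real.strictAntiOn_arccos.le_iff_ge (hmem x) (hmem y), real_inner_comm (z : Space d),
    real_inner_comm (z : Space d)]

lemma coneOver_voronoiCell (x : Fin n → Sphere d) (i : Fin n) :
    coneOver (voronoiCell x i) = normalCone (fun j => (x j : Space d)) i := by
  ext y
  by_cases hy : y = 0
  · subst hy
    simp [coneOver, zero_mem_normalCone]
  rw [← mem_normalCone_inv_norm_smul hy]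
  simp only [coneOver, hy, false_or, voronoiCell, geodesicDist_le_iff, Set.mem_ofPred_eq,
    normalCone, Set.mem_image]
  constructor
  · rintro ⟨z, hz, h⟩
    rwa [← h]
  · intro h
    exact ⟨⟨‖y‖⁻¹ • y, by simp [norm_smul, hy]⟩, h, rfl⟩

/-- Cutting with the sphere merges no faces, since a face of the cone is recovered by scaling its
unit vectors. -/
lemma numSphericalFaces_voronoiCell (x : Fin n → Sphere d) (i : Fin n) {k : ℕ} (hk : k ≤ d) :
    numSphericalFaces (voronoiCell x i) k =
      {S : Finset (Fin n) | i ∈ S ∧ IsFaceSet (fun j => (x j : Space d)) S ∧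
        Module.finrank ℝ (vectorSpan ℝ ((fun j => (x j : Space d)) '' (S : Set (Fin n)))) =
          d - k}.ncard := by
  rw [numSphericalFaces, sphericalFaces, coneOver_voronoiCell,
    polyhedronFaces_normalCone _ i (m := d - k) (by omega), Set.InjOn.ncard_image,
    Set.InjOn.ncard_image]
  · refine (normalConeFace_injOn _ i).mono ?_
    rintro S ⟨h1, h2, -⟩
    exact ⟨h1, h2⟩
  · have key : ∀ S T : Finset (Fin n),
        normalConeFace (fun j => (x j : Space d)) i S ∩ Metric.sphere 0 1 =
          normalConeFace (fun j => (x j : Space d)) i T ∩ Metric.sphere 0 1 →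
        normalConeFace (fun j => (x j : Space d)) i S ⊆
          normalConeFace (fun j => (x j : Space d)) i T := by
      intro S T h y hy
      by_cases hy0 : y = 0
      · rw [hy0]
        exact zero_mem_normalConeFace _ i T
      have h1 : ‖y‖⁻¹ • y ∈ normalConeFace (fun j => (x j : Space d)) i T := by
        have : ‖y‖⁻¹ • y ∈ normalConeFace (fun j => (x j : Space d)) i S ∩ Metric.sphere 0 1 :=
          ⟨smul_mem_normalConeFace hy (by positivity), by simp [norm_smul, hy0]⟩
        exact (h ▸ this).1
      have h2 := smul_mem_normalConeFace h1 (norm_nonneg y)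
      rwa [smul_smul, mul_inv_cancel₀ (norm_ne_zero_iff.2 hy0), one_smul] at h2
    rintro _ ⟨S, -, rfl⟩ _ ⟨T, -, rfl⟩ h
    exact (key S T h).antisymm (key T S h.symm)

lemma numFaces_pointHull (x : Fin n → Sphere d) (m : ℕ) :
    numFaces (pointHull x) m =
      {S : Finset (Fin n) | S.Nonempty ∧ IsFaceSet (fun j => (x j : Space d)) S ∧
        Module.finrank ℝ (vectorSpan ℝ ((fun j => (x j : Space d)) '' (S : Set (Fin n)))) =
          m}.ncard := by
  rw [numFaces, pointHull, polyhedronFaces_convexHull_range, Set.InjOn.ncard_image]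
  refine (convexHull_image_injOn _).mono ?_
  rintro S ⟨-, h, -⟩
  exact h

/-- Up to `d + 2` points are affinely independent; a larger set contains `d + 2` such points and has
dimension at least `d + 1 > m`. -/
lemma InGeneralPosition.finrank_vectorSpan_eq_iff {x : Fin n → Space d}
    (h : InGeneralPosition x) {S : Finset (Fin n)} (hS : S.Nonempty) {m : ℕ} (hm : m ≤ d) :
    Module.finrank ℝ (vectorSpan ℝ (x '' (S : Set (Fin n)))) = m ↔ S.card = m + 1 := by
  have hind : ∀ T : Finset (Fin n), T.Nonempty → T.card ≤ d + 2 →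
      Module.finrank ℝ (vectorSpan ℝ (x '' (T : Set (Fin n)))) + 1 = T.card := by
    intro T hT hc
    have : Nonempty T := hT.to_subtype
    have h1 := (h T hc).finrank_vectorSpan_add_one
    have h2 : Set.range (fun i : T => x i) = x '' (T : Set (Fin n)) := by
      ext; simp
    rwa [h2, Fintype.card_coe] at h1
  rcases le_total S.card (d + 2) with hc | hc
  · have := hind S hS hc
    omega
  · obtain ⟨T, hTS, hT⟩ := Finset.exists_subset_card_eq hc
    have h1 := hind T (Finset.card_pos.1 (by omega)) hT.le
    have h2 : Module.finrank ℝ (vectorSpan ℝ (x '' (T : Set (Fin n)))) ≤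
        Module.finrank ℝ (vectorSpan ℝ (x '' (S : Set (Fin n)))) :=
      Submodule.finrank_mono (vectorSpan_mono ℝ (Set.image_mono (by exact_mod_cast hTS)))
    omega

lemma isFaceSet_linearIsometryEquiv_comp (e : Space d ≃ₗᵢ[ℝ] Space d) (x : Fin n → Space d)
    (S : Finset (Fin n)) : IsFaceSet (fun j => e (x j)) S ↔ IsFaceSet x S := by
  constructor
  · rintro ⟨u, c, h⟩
    refine ⟨e.symm u, c, ?_⟩
    simpa only [← e.inner_map_map (e.symm u), e.apply_symm_apply] using h
  · rintro ⟨u, c, h⟩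
    refine ⟨e u, c, ?_⟩
    simpa only [e.inner_map_map] using h

lemma InGeneralPosition.linearIsometryEquiv_comp {x : Fin n → Space d}
    (h : InGeneralPosition x) (e : Space d ≃ₗᵢ[ℝ] Space d) :
    InGeneralPosition fun j => e (x j) := fun S hS =>
  (h S hS).map' e.toLinearEquiv.toLinearMap.toAffineMap e.injective

/-- The configuration moved by an orthogonal transformation. -/
noncomputable def rotatedPoints (e : Space d ≃ₗᵢ[ℝ] Space d) (x : Fin n → Sphere d)
    (j : Fin n) : Sphere d :=
  ⟨e (x j), by simp⟩

/-- Orthogonal maps preserve inner products, hence carry cells to cells. -/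
lemma rotatedCell_eq (O : Sphere d → (Space d ≃ₗᵢ[ℝ] Space d)) (x : Fin n → Sphere d)
    (i : Fin n) : rotatedCell O x i = voronoiCell (rotatedPoints (O (x i)) x) i := by
  have hinner : ∀ (z : Space d) (j : Fin n), inner ℝ (O (x i) z) (O (x i) (x j)) =
      inner ℝ z (x j : Space d) := fun z j => (O (x i)).inner_map_map _ _
  ext y
  simp only [rotatedCell, voronoiCell, Set.mem_image, Set.mem_ofPred_eq, geodesicDist_le_iff,
    rotatedPoints]
  constructor
  · rintro ⟨_, ⟨z, hz, rfl⟩, rfl⟩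
    exact ⟨⟨O (x i) z, by simp⟩, fun j => by simpa only [hinner] using hz j, rfl⟩
  · rintro ⟨z, hz, rfl⟩
    refine ⟨(O (x i)).symm z, ⟨⟨(O (x i)).symm z, by simp⟩, fun j => ?_, rfl⟩, by simp⟩
    rw [← hinner, ← hinner, (O (x i)).apply_symm_apply]
    exact hz j

open Classical in
lemma numSphericalFaces_rotatedCell {O : Sphere d → (Space d ≃ₗᵢ[ℝ] Space d)}
    {x : Fin n → Sphere d} (h : InGeneralPosition fun j => (x j : Space d)) (i : Fin n) {k : ℕ}
    (hk : k ≤ d) :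
    (numSphericalFaces (rotatedCell O x i) k : ℝ) =
      ∑ S ∈ Finset.powersetCard (d - k + 1) Finset.univ,
        if i ∈ S ∧ IsFaceSet (fun j => (x j : Space d)) S then 1 else 0 := by
  rw [rotatedCell_eq, numSphericalFaces_voronoiCell _ i hk, Finset.sum_boole,
    ← Set.ncard_coe_finset]
  congr 2
  ext S
  have h1 := isFaceSet_linearIsometryEquiv_comp (O (x i)) (fun j => (x j : Space d)) S
  have h2 := fun hS : S.Nonempty =>
    (h.linearIsometryEquiv_comp (O (x i))).finrank_vectorSpan_eq_iff hS (m := d - k) (by omega)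
  simp only [rotatedPoints, Set.mem_ofPred_eq, Finset.coe_filter, Finset.mem_powersetCard,
    Finset.subset_univ, true_and]
  constructor
  · rintro ⟨hi, hf, hr⟩
    exact ⟨(h2 ⟨i, hi⟩).1 hr, hi, h1.1 hf⟩
  · rintro ⟨hc, hi, hf⟩
    exact ⟨hi, h1.2 hf, (h2 ⟨i, hi⟩).2 hc⟩

open Classical in
lemma numFaces_pointHull_of_inGeneralPosition {x : Fin n → Sphere d}
    (h : InGeneralPosition fun j => (x j : Space d)) {m : ℕ} (hm : m ≤ d) :
    (numFaces (pointHull x) m : ℝ) = ∑ S ∈ Finset.powersetCard (m + 1) Finset.univ,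
        if IsFaceSet (fun j => (x j : Space d)) S then 1 else 0 := by
  rw [numFaces_pointHull, Finset.sum_boole, ← Set.ncard_coe_finset]
  congr 2
  ext S
  have h2 := fun hS : S.Nonempty => h.finrank_vectorSpan_eq_iff hS hm
  simp only [Set.mem_ofPred_eq, Finset.coe_filter, Finset.mem_powersetCard,
    Finset.subset_univ, true_and]
  constructor
  · rintro ⟨hS, hf, hr⟩
    exact ⟨(h2 hS).1 hr, hf⟩
  · rintro ⟨hc, hf⟩
    have hS : S.Nonempty := Finset.card_pos.1 (by omega)
    exact ⟨hS, hf, (h2 hS).2 hc⟩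

end Counting

/-! ### Measurability by projecting closed sets. -/

section Measurability

/-- The projection of a σ-compact set is σ-compact, so here it is a countable union of closed sets.
-/
lemma measurableSet_exists_of_isClosed {α β : Type*} [TopologicalSpace α] [T2Space α]
    [SigmaCompactSpace α] [MeasurableSpace α] [BorelSpace α] [TopologicalSpace β]
    [SigmaCompactSpace β] {C : Set (α × β)} (hC : IsClosed C) :
    MeasurableSet {a | ∃ b, (a, b) ∈ C} := by
  have h1 : IsSigmaCompact (Prod.fst '' C) :=
    (isSigmaCompact_univ.of_isClosed_subset hC (Set.subset_univ C)).image continuous_fst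
  have h2 : {a | ∃ b, (a, b) ∈ C} = Prod.fst '' C := by
    ext a; simp
  rw [h2]
  obtain ⟨K, hK, hKC⟩ := h1
  rw [← hKC]
  exact MeasurableSet.iUnion fun m => (hK m).isClosed.measurableSet

/-- Rescaling the functional makes the gap at least `1`, which turns strict inequalities into closed
conditions. -/
lemma isFaceSet_iff_gap {ι E : Type*} [Finite ι] [NormedAddCommGroup E] [InnerProductSpace ℝ E]
    {x : ι → E} {S : Finset ι} : IsFaceSet x S ↔ ∃ p : E × ℝ,
      (∀ i ∈ S, inner ℝ p.1 (x i) = p.2) ∧ ∀ j ∉ S, inner ℝ p.1 (x j) ≤ p.2 - 1 := by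
  constructor
  · rintro ⟨u, c, h1, h2⟩
    have key : ∀ᶠ ε in nhds (0 : ℝ), ∀ j, j ∉ S → inner ℝ u (x j) + ε < c := by
      rw [Filter.eventually_all]
      intro j
      by_cases hj : j ∈ S
      · simp [hj]
      · have hc : Continuous fun ε : ℝ => inner ℝ u (x j) + ε := by fun_prop
        have : ∀ᶠ ε in nhds (0 : ℝ), inner ℝ u (x j) + ε < c :=
          hc.continuousAt.eventually_lt continuousAt_const (by simpa using h2 j hj)
        exact this.mono fun ε hε _ => hε
    obtain ⟨ε, h3, h4⟩ :=
      ((key.filter_mono nhdsWithin_le_nhds).and (self_mem_nhdsWithin (s := Set.Ioi 0))).exists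
    have hε : 0 < ε := h4
    refine ⟨(ε⁻¹ • u, ε⁻¹ * c), fun i hi => ?_, fun j hj => ?_⟩
    · simp [inner_smul_left, h1 i hi]
    · have h5 : ε⁻¹ * (inner ℝ u (x j) + ε) ≤ ε⁻¹ * c :=
        mul_le_mul_of_nonneg_left (h3 j hj).le (inv_nonneg.2 hε.le)
      rw [mul_add, inv_mul_cancel₀ hε.ne'] at h5
      simp only [inner_smul_left, RCLike.conj_to_real]
      linarith
  · rintro ⟨⟨u, c⟩, h1, h2⟩
    exact ⟨u, c, h1, fun j hj => (h2 j hj).trans_lt (by simp)⟩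

variable {d n : ℕ}

lemma measurableSet_isFaceSet (S : Finset (Fin n)) :
    MeasurableSet {x : Fin n → Sphere d | IsFaceSet (fun j => (x j : Space d)) S} := by
  simp only [isFaceSet_iff_gap]
  refine measurableSet_exists_of_isClosed
    (C := {p : (Fin n → Sphere d) × (Space d × ℝ) |
      (∀ i ∈ S, inner ℝ p.2.1 (p.1 i : Space d) = p.2.2) ∧
        ∀ j ∉ S, inner ℝ p.2.1 (p.1 j : Space d) ≤ p.2.2 - 1}) ?_
  have hc : ∀ i, Continuous fun p : (Fin n → Sphere d) × (Space d × ℝ) =>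
      (inner ℝ p.2.1 (p.1 i : Space d) : ℝ) := fun i => by fun_prop
  rw [Set.ofPred_and]
  simp only [Set.ofPred_forall]
  refine IsClosed.inter ?_ ?_
  · exact isClosed_iInter fun i => isClosed_iInter fun _ => isClosed_eq (hc i) (by fun_prop)
  · exact isClosed_iInter fun i => isClosed_iInter fun _ => isClosed_le (hc i) (by fun_prop)

lemma measurableSet_mem_affineSpan {ι : Type*} [Fintype ι] :
    MeasurableSet {p : (ι → Sphere d) × Sphere d |
      (p.2 : Space d) ∈ affineSpan ℝ (Set.range fun i => (p.1 i : Space d))} := by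
  have h : ∀ p : (ι → Sphere d) × Sphere d,
      (p.2 : Space d) ∈ affineSpan ℝ (Set.range fun i => (p.1 i : Space d)) ↔
        ∃ w : ι → ℝ, ∑ i, w i = 1 ∧ (p.2 : Space d) = ∑ i, w i • (p.1 i : Space d) := by
    intro p
    constructor
    · intro hp
      obtain ⟨w, hw, h⟩ := eq_affineCombination_of_mem_affineSpan_of_fintype hp
      rw [Finset.affineCombination_eq_linear_combination _ _ _ hw] at h
      exact ⟨w, hw, h⟩
    · rintro ⟨w, hw, h⟩
      rw [h, ← Finset.affineCombination_eq_linear_combination _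
        (fun i => (p.1 i : Space d)) _ hw]
      exact affineCombination_mem_affineSpan hw _
  simp only [h]
  refine measurableSet_exists_of_isClosed
    (C := {q : ((ι → Sphere d) × Sphere d) × (ι → ℝ) | ∑ i, q.2 i = 1 ∧
      (q.1.2 : Space d) = ∑ i, q.2 i • (q.1.1 i : Space d)}) ?_
  exact (isClosed_eq (by fun_prop) (by fun_prop)).inter (isClosed_eq (by fun_prop) (by fun_prop))

end Measurability

/-! ### Hyperplane sections of the sphere are null. -/

section NullSets

variable {d : ℕ}

/-- The set lies in the boundary of the convex cone `c * ‖y‖ ≤ ⟨u, y⟩`, and boundaries of convex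
sets are null. Were `y` interior, both `y ± t • v` with `v ⟂ y`, `v ≠ 0` would lie in the cone;
their norms exceed `‖y‖`, while their inner products with `u` average to `c * ‖y‖`. -/
lemma volume_inner_eq_pos_mul_norm (hd : 1 ≤ d) (u : Space d) {c : ℝ} (hc : 0 < c) :
    volume {y : Space d | inner ℝ u y = c * ‖y‖} = 0 := by
  let C : Set (Space d) := {y | c * ‖y‖ ≤ inner ℝ u y}
  have hclosed : IsClosed C := isClosed_le (by fun_prop) (by fun_prop)
  have hconv : Convex ℝ C := by
    intro y hy z hz a b ha hb _
    change c * ‖a • y + b • z‖ ≤ inner ℝ u (a • y + b • z)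
    have h1 : ‖a • y + b • z‖ ≤ a * ‖y‖ + b * ‖z‖ := by
      refine (norm_add_le _ _).trans_eq ?_
      rw [norm_smul_of_nonneg ha, norm_smul_of_nonneg hb]
    have h2 : c * ‖y‖ ≤ inner ℝ u y := hy
    have h3 : c * ‖z‖ ≤ inner ℝ u z := hz
    rw [inner_add_right, inner_smul_right, inner_smul_right]
    calc c * ‖a • y + b • z‖ ≤ c * (a * ‖y‖ + b * ‖z‖) := mul_le_mul_of_nonneg_left h1 hc.le
      _ = a * (c * ‖y‖) + b * (c * ‖z‖) := by ring
      _ ≤ _ := add_le_add (mul_le_mul_of_nonneg_left h2 ha) (mul_le_mul_of_nonneg_left h3 hb)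
  refine measure_mono_null ?_ (hconv.addHaar_frontier volume)
  intro y hy
  have hy' : inner ℝ u y = c * ‖y‖ := hy
  rw [hclosed.frontier_eq]
  refine ⟨hy'.ge, fun hint => ?_⟩
  have hne : (Submodule.span ℝ {y})ᗮ ≠ ⊥ := by
    intro hbot
    have h1 := Submodule.finrank_add_finrank_orthogonal (Submodule.span ℝ {y})
    have h2 := finrank_span_le_card (R := ℝ) ({y} : Set (Space d))
    rw [hbot, finrank_bot, finrank_euclideanSpace_fin] at h1
    simp only [Set.toFinset_singleton, Finset.card_singleton] at h2
    omega
  obtain ⟨v, hv, hv0⟩ := Submodule.exists_mem_ne_zero_of_ne_bot hne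
  have hyv : inner ℝ y v = 0 := Submodule.mem_orthogonal_singleton_iff_inner_right.1 hv
  have hnhds : ∀ w : Space d, ∀ᶠ t in nhdsWithin (0 : ℝ) (Set.Ioi 0), y + t • w ∈ C := by
    intro w
    refine Filter.Eventually.filter_mono nhdsWithin_le_nhds ?_
    have hcont : Continuous fun t : ℝ => y + t • w := by fun_prop
    exact hcont.continuousAt.eventually
      (by simpa using mem_interior_iff_mem_nhds.1 hint)
  obtain ⟨t, ⟨h1, h2⟩, h3⟩ := (((hnhds v).and (hnhds (-v))).and
    (self_mem_nhdsWithin (s := Set.Ioi 0))).exists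
  have ht : 0 < t := h3
  have hlt : ∀ w : Space d, inner ℝ y w = 0 → w ≠ 0 → ‖y‖ < ‖y + t • w‖ := by
    intro w hw hw0
    have h4 : ‖y + t • w‖ * ‖y + t • w‖ = ‖y‖ * ‖y‖ + ‖t • w‖ * ‖t • w‖ :=
      norm_add_sq_eq_norm_sq_add_norm_sq_real (by rw [inner_smul_right, hw, mul_zero])
    have h5 : 0 < ‖t • w‖ := norm_pos_iff.2 (smul_ne_zero ht.ne' hw0)
    exact lt_of_mul_self_lt_mul_self₀ (norm_nonneg _) (by nlinarith)
  have h6 := hlt v hyv hv0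
  have h7 := hlt (-v) (by rw [inner_neg_right, hyv, neg_zero]) (neg_ne_zero.2 hv0)
  have h8 : c * ‖y + t • v‖ ≤ inner ℝ u (y + t • v) := h1
  have h9 : c * ‖y + t • -v‖ ≤ inner ℝ u (y + t • -v) := h2
  rw [inner_add_right, inner_smul_right, hy'] at h8 h9
  rw [inner_neg_right] at h9
  have h10 := mul_lt_mul_of_pos_left h6 hc
  have h11 := mul_lt_mul_of_pos_left h7 hc
  linarith

lemma volume_inner_eq_mul_norm (hd : 1 ≤ d) {u : Space d} (hu : u ≠ 0) (c : ℝ) :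
    volume {y : Space d | inner ℝ u y = c * ‖y‖} = 0 := by
  rcases lt_trichotomy c 0 with hc | rfl | hc
  · convert volume_inner_eq_pos_mul_norm hd (-u) (neg_pos.2 hc) using 3
    ext y
    simp only [inner_neg_left, neg_mul, neg_inj]
  · have hne : (Submodule.span ℝ {u})ᗮ ≠ ⊤ := by
      intro h
      have : u ∈ (Submodule.span ℝ {u})ᗮ := h ▸ Submodule.mem_top
      exact hu (inner_self_eq_zero.1 (Submodule.mem_orthogonal_singleton_iff_inner_right.1 this))
    refine measure_mono_null (fun y hy => ?_) (Measure.addHaar_submodule volume _ hne)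
    have hy' : inner ℝ u y = 0 * ‖y‖ := hy
    rw [zero_mul] at hy'
    exact Submodule.mem_orthogonal_singleton_iff_inner_right.2 hy'
  · exact volume_inner_eq_pos_mul_norm hd u hc

open Pointwise in
-- Spherical measure is proportional to the volume of the cone over a set, and on that cone the
-- equation becomes `⟨u, y⟩ = c * ‖y‖`.
lemma sphereUniform_inner_eq (hd : 1 ≤ d) {u : Space d} (hu : u ≠ 0) (c : ℝ) :
    sphereUniform d {q : Sphere d | inner ℝ u (q : Space d) = c} = 0 := by
  have hmeas : MeasurableSet {q : Sphere d | inner ℝ u (q : Space d) = c} :=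
    (isClosed_eq (by fun_prop) (by fun_prop)).measurableSet
  have hnull : volume (Set.Ioo (0 : ℝ) 1 •
      ((fun q : Sphere d => (q : Space d)) '' {q : Sphere d | inner ℝ u (q : Space d) = c}))
        = 0 := by
    refine measure_mono_null ?_ (volume_inner_eq_mul_norm hd hu c)
    rintro _ ⟨t, ht, _, ⟨q, hq, rfl⟩, rfl⟩
    have hq' : inner ℝ u (q : Space d) = c := hq
    change inner ℝ u (t • (q : Space d)) = c * ‖t • (q : Space d)‖
    rw [inner_smul_right, hq', norm_smul_of_nonneg ht.1.le, mem_sphere_zero_iff_norm.1 q.2,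
      mul_one, mul_comm]
  rw [sphereUniform, Measure.smul_apply, Measure.toSphere_apply' _ hmeas, hnull, mul_zero,
    smul_zero]

lemma sphereUniform_affineSubspace (hd : 1 ≤ d) {A : AffineSubspace ℝ (Space d)} (hA : A ≠ ⊤) :
    sphereUniform d {q : Sphere d | (q : Space d) ∈ A} = 0 := by
  rcases A.eq_bot_or_nonempty with rfl | ⟨a, ha⟩
  · exact measure_mono_null (t := ∅)
      (fun q hq => AffineSubspace.notMem_bot ℝ (Space d) (q : Space d) hq) measure_empty
  · rw [Ne, ← AffineSubspace.direction_eq_top_iff_of_nonempty ⟨a, ha⟩,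
      ← Submodule.orthogonal_eq_bot_iff] at hA
    obtain ⟨u, hu, hu0⟩ := Submodule.exists_mem_ne_zero_of_ne_bot hA
    refine measure_mono_null (fun q hq => ?_) (sphereUniform_inner_eq hd hu0 (inner ℝ u a))
    have h := (Submodule.mem_orthogonal' _ _).1 hu _ (AffineSubspace.vsub_mem_direction hq ha)
    rw [vsub_eq_sub, inner_sub_right, sub_eq_zero] at h
    exact h

lemma affineSpan_range_ne_top {ι : Type*} [Fintype ι] (p : ι → Space d)
    (hι : Fintype.card ι ≤ d + 1) : affineSpan ℝ (Set.range p) ≠ ⊤ := by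
  intro h
  have h1 : vectorSpan ℝ (Set.range p) = ⊤ := by
    rw [← direction_affineSpan, h, AffineSubspace.direction_top]
  rcases isEmpty_or_nonempty ι with hι' | hι'
  · rw [Set.range_eq_empty, AffineSubspace.span_empty] at h
    exact bot_ne_top h
  · have h2 := finrank_vectorSpan_range_add_one_le ℝ p
    rw [h1, finrank_top, finrank_euclideanSpace_fin] at h2
    omega

end NullSets

/-! ### Almost sure general position and the random index. -/

section Probability

variable {d n : ℕ} {Ω : Type*} [MeasurableSpace Ω] {P : Measure Ω} [IsProbabilityMeasure P]
  {X : Fin n → Ω → Sphere d}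

/-- By independence and Fubini, the points of `T` may be frozen; their span is then a fixed proper
affine subspace. -/
lemma ae_notMem_affineSpan (hd : 1 ≤ d) (hX : ∀ i, HasLaw (X i) (sphereUniform d) P)
    (hXindep : iIndepFun X P) {j : Fin n} {T : Finset (Fin n)} (hj : j ∉ T)
    (hT : T.card ≤ d + 1) :
    ∀ᵐ ω ∂P, (X j ω : Space d) ∉ affineSpan ℝ (Set.range fun i : T => (X i ω : Space d)) := by
  have hmT : AEMeasurable (fun ω (i : T) => X i ω) P :=
    aemeasurable_pi_lambda _ fun i => (hX i).aemeasurable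
  have hmj := (hX j).aemeasurable
  have hindep : IndepFun (fun ω (i : T) => X i ω) (X j) P :=
    (hXindep.indepFun_finset₀ T {j} (Finset.disjoint_singleton_right.2 hj)
      fun i => (hX i).aemeasurable).comp (φ := id)
      (ψ := fun q : ({j} : Finset (Fin n)) → Sphere d => q ⟨j, Finset.mem_singleton_self j⟩)
      measurable_id (measurable_pi_apply _)
  have hB := measurableSet_mem_affineSpan (d := d) (ι := T)
  have hprod := hindep.map_prod_eq_prod_map_map hmT hmj
  have : IsProbabilityMeasure (P.map (X j)) := Measure.isProbabilityMeasure_map hmj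
  have hzero : (P.map (fun ω (i : T) => X i ω)).prod (P.map (X j))
      {p : (T → Sphere d) × Sphere d |
        (p.2 : Space d) ∈ affineSpan ℝ (Set.range fun i => (p.1 i : Space d))} = 0 := by
    rw [Measure.measure_prod_null hB, (hX j).map_eq]
    refine Filter.Eventually.of_forall fun p => ?_
    exact sphereUniform_affineSubspace hd
      (affineSpan_range_ne_top (fun i => (p i : Space d)) ((Fintype.card_coe T).trans_le hT))
  rw [← hprod, Measure.map_apply_of_aemeasurable (hmT.prodMk hmj) hB] at hzero
  exact measure_eq_zero_iff_ae_notMem.1 hzero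

lemma inGeneralPosition_of_notMem_affineSpan {x : Fin n → Space d}
    (h : ∀ (j : Fin n) (T : Finset (Fin n)), j ∉ T → T.card ≤ d + 1 →
      x j ∉ affineSpan ℝ (Set.range fun i : T => x i)) : InGeneralPosition x := by
  classical
  intro S
  induction S using Finset.induction_on with
  | empty => exact fun _ => affineIndependent_of_subsingleton ℝ _
  | insert j T hj ih =>
    intro hc
    rw [Finset.card_insert_of_notMem hj] at hc
    have hind := ih (by omega)
    let i₀ : (insert j T : Finset (Fin n)) := ⟨j, Finset.mem_insert_self j T⟩
    have hmem : ∀ y : (insert j T : Finset (Fin n)), y ≠ i₀ → (y : Fin n) ∈ T := fun y hy =>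
      (Finset.mem_insert.1 y.2).resolve_left fun h => hy (Subtype.ext h)
    refine AffineIndependent.affineIndependent_of_notMem_span (i := i₀) ?_ ?_
    · exact hind.comp_embedding
        ⟨fun y : {y : (insert j T : Finset (Fin n)) // y ≠ i₀} => (⟨y.1, hmem y.1 y.2⟩ : T),
          fun y z hyz => Subtype.ext (Subtype.ext (congrArg (fun w : T => (w : Fin n)) hyz))⟩
    · refine fun hcon => h j T hj (by omega) (affineSpan_mono ℝ ?_ hcon)
      rintro _ ⟨y, hy, rfl⟩
      exact ⟨⟨y, hmem y hy⟩, rfl⟩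

lemma ae_inGeneralPosition (hd : 1 ≤ d) (hX : ∀ i, HasLaw (X i) (sphereUniform d) P)
    (hXindep : iIndepFun X P) :
    ∀ᵐ ω ∂P, InGeneralPosition fun i => (X i ω : Space d) := by
  have h : ∀ᵐ ω ∂P, ∀ (j : Fin n) (T : Finset (Fin n)), j ∉ T → T.card ≤ d + 1 →
      (X j ω : Space d) ∉ affineSpan ℝ (Set.range fun i : T => (X i ω : Space d)) := by
    simp only [ae_all_iff]
    exact fun j T hj hT => ae_notMem_affineSpan hd hX hXindep hj hT
  exact h.mono fun ω hω => inGeneralPosition_of_notMem_affineSpan hω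

lemma integral_ite_eq_of_hasLaw_uniformOn {N : Ω → Fin n}
    (hN : HasLaw N (uniformOn (Set.univ : Set (Fin n))) P) (i : Fin n) :
    ∫ ω, (if N ω = i then (1 : ℝ) else 0) ∂P = (n : ℝ)⁻¹ := by
  have h1 : ∫ ω, (if N ω = i then (1 : ℝ) else 0) ∂P =
      ∫ k, (if k = i then (1 : ℝ) else 0) ∂(P.map N) :=
    (integral_map (f := fun k : Fin n => if k = i then (1 : ℝ) else 0) hN.aemeasurable
      (measurable_of_finite _).aestronglyMeasurable).symm
  have h2 : (fun k : Fin n => if k = i then (1 : ℝ) else 0) =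
      Set.indicator {i} fun _ => (1 : ℝ) := by
    ext k; simp [Set.indicator_apply]
  rw [h1, hN.map_eq, h2, integral_indicator_const _ (measurableSet_singleton i),
    measureReal_def, uniformOn_univ, Measure.count_singleton, Fintype.card_fin]
  simp

/-- The mean of a bounded function of a random sample and an independent uniform index. -/
lemma integrable_and_integral_uniform_index {β : Type*} [MeasurableSpace β] {Y : Ω → β}
    (hY : AEMeasurable Y P) {N : Ω → Fin n}
    (hN : HasLaw N (uniformOn (Set.univ : Set (Fin n))) P) (hindep : IndepFun N Y P)
    {h : Fin n → β → ℝ} (hmeas : ∀ i, Measurable (h i)) {C : ℝ} (hC : ∀ i y, ‖h i y‖ ≤ C) :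
    Integrable (fun ω => h (N ω) (Y ω)) P ∧
      ∫ ω, h (N ω) (Y ω) ∂P = (n : ℝ)⁻¹ * ∫ ω, ∑ i, h i (Y ω) ∂P := by
  -- Splitting over the values of `N` lets independence factor each term.
  have hsum : ∀ ω, h (N ω) (Y ω) = ∑ i, (if N ω = i then (1 : ℝ) else 0) * h i (Y ω) := by
    intro ω; simp
  have hφm : ∀ i : Fin n, Measurable fun k : Fin n => if k = i then (1 : ℝ) else 0 := fun i =>
    measurable_of_finite _
  have hφ : ∀ i, AEStronglyMeasurable (fun ω => if N ω = i then (1 : ℝ) else 0) P := fun i =>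
    ((hφm i).comp_aemeasurable hN.aemeasurable).aestronglyMeasurable
  have hhY : ∀ i, AEStronglyMeasurable (fun ω => h i (Y ω)) P := fun i =>
    ((hmeas i).comp_aemeasurable hY).aestronglyMeasurable
  have hint : ∀ i, Integrable (fun ω => h i (Y ω)) P := fun i =>
    Integrable.of_bound (hhY i) C (Filter.Eventually.of_forall fun ω => hC i _)
  have hint' : ∀ i, Integrable (fun ω => (if N ω = i then (1 : ℝ) else 0) * h i (Y ω)) P :=
    fun i => (hint i).bdd_mul (c := 1) (hφ i) (Filter.Eventually.of_forall fun ω => by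
      split_ifs <;> simp)
  simp only [hsum]
  refine ⟨integrable_finsetSum _ fun i _ => hint' i, ?_⟩
  rw [integral_finsetSum _ fun i _ => hint' i, integral_finsetSum _ fun i _ => hint i,
    Finset.mul_sum]
  refine Finset.sum_congr rfl fun i _ => ?_
  have := (hindep.comp (hφm i) (hmeas i)).integral_fun_mul_eq_mul_integral (hφ i) (hhY i)
  simp only [Function.comp_apply] at this
  rw [this, integral_ite_eq_of_hasLaw_uniformOn hN i]

open Classical in
-- Double counting: each `S` is counted once for each of its `m` elements.
lemma sum_sum_mem_and_isFaceSet (x : Fin n → Space d) (m : ℕ) :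
    ∑ i, ∑ S ∈ Finset.powersetCard m Finset.univ,
        (if i ∈ S ∧ IsFaceSet x S then (1 : ℝ) else 0) =
      m * ∑ S ∈ Finset.powersetCard m Finset.univ, if IsFaceSet x S then (1 : ℝ) else 0 := by
  rw [Finset.sum_comm, Finset.mul_sum]
  refine Finset.sum_congr rfl fun S hS => ?_
  by_cases hf : IsFaceSet x S
  · simp [hf, (Finset.mem_powersetCard.1 hS).2]
  · simp [hf]

end Probability

end SphericalVoronoi

theorem theorem2p4 {d n k : ℕ} (hd : 1 ≤ d) (hn : d + 1 ≤ n) (hk : k ≤ d)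
    {Ω : Type*} [MeasurableSpace Ω] (P : Measure Ω) [IsProbabilityMeasure P]
    (X : Fin n → Ω → SphericalVoronoi.Sphere d)
    (hX : ∀ i, HasLaw (X i) (SphericalVoronoi.sphereUniform d) P)
    (hXindep : iIndepFun X P)
    (N : Ω → Fin n) (hN : HasLaw N (uniformOn (Set.univ : Set (Fin n))) P)
    (hNindep : IndepFun N (fun ω i => X i ω) P)
    (O : SphericalVoronoi.Sphere d →
      (SphericalVoronoi.Space d ≃ₗᵢ[ℝ] SphericalVoronoi.Space d))
    (hO : SphericalVoronoi.IsPoleRotation O) :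
    Integrable (fun ω => (SphericalVoronoi.numSphericalFaces
      (SphericalVoronoi.rotatedCell O (fun i => X i ω) (N ω)) k : ℝ)) P ∧
    Integrable (fun ω => (SphericalVoronoi.numFaces
      (SphericalVoronoi.pointHull (fun i => X i ω)) (d - k) : ℝ)) P ∧
    ∫ ω, (SphericalVoronoi.numSphericalFaces
      (SphericalVoronoi.rotatedCell O (fun i => X i ω) (N ω)) k : ℝ) ∂P =
      ((d : ℝ) - k + 1) / n *
        ∫ ω, (SphericalVoronoi.numFaces
          (SphericalVoronoi.pointHull (fun i => X i ω)) (d - k) : ℝ) ∂P := by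
  classical
  open SphericalVoronoi in
  have hgp := ae_inGeneralPosition hd hX hXindep
  have hXm : AEMeasurable (fun ω i => X i ω) P :=
    aemeasurable_pi_lambda _ fun i => (hX i).aemeasurable
  let 𝒮 : Finset (Finset (Fin n)) := Finset.powersetCard (d - k + 1) Finset.univ
  let g : (Fin n → Sphere d) → ℝ := fun x =>
    ∑ S ∈ 𝒮, if IsFaceSet (fun j => (x j : Space d)) S then 1 else 0
  let h : Fin n → (Fin n → Sphere d) → ℝ := fun i x =>
    ∑ S ∈ 𝒮, if i ∈ S ∧ IsFaceSet (fun j => (x j : Space d)) S then 1 else 0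
  have hgm : Measurable g := Finset.measurable_sum _ fun S _ =>
    Measurable.ite (measurableSet_isFaceSet S) measurable_const measurable_const
  have hhm : ∀ i, Measurable (h i) := fun i => Finset.measurable_sum _ fun S _ =>
    Measurable.ite ((MeasurableSet.const (i ∈ S)).inter (measurableSet_isFaceSet S))
      measurable_const measurable_const
  have hgb : ∀ x, ‖g x‖ ≤ 𝒮.card := fun x => by
    refine (norm_sum_le_of_le 𝒮 (n := fun _ => 1) fun S _ => ?_).trans_eq (by simp)
    split_ifs <;> simp
  have hhb : ∀ i x, ‖h i x‖ ≤ 𝒮.card := fun i x => by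
    refine (norm_sum_le_of_le 𝒮 (n := fun _ => 1) fun S _ => ?_).trans_eq (by simp)
    split_ifs <;> simp
  -- The face numbers agree almost surely with bounded measurable functions, which yields
  -- integrability as well as the integrals.
  have hcell : (fun ω => h (N ω) (fun i => X i ω)) =ᵐ[P] fun ω =>
      (numSphericalFaces (rotatedCell O (fun i => X i ω) (N ω)) k : ℝ) :=
    hgp.mono fun ω hω => (numSphericalFaces_rotatedCell hω (N ω) hk).symm
  have hhull : (fun ω => g (fun i => X i ω)) =ᵐ[P] fun ω =>
      (numFaces (pointHull fun i => X i ω) (d - k) : ℝ) :=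
    hgp.mono fun ω hω => (numFaces_pointHull_of_inGeneralPosition hω (Nat.sub_le d k)).symm
  have hgint : Integrable (fun ω => g (fun i => X i ω)) P :=
    Integrable.of_bound (hgm.comp_aemeasurable hXm).aestronglyMeasurable _
      (Filter.Eventually.of_forall fun ω => hgb _)
  obtain ⟨hhint, hheq⟩ := integrable_and_integral_uniform_index hXm hN hNindep hhm hhb
  refine ⟨hhint.congr hcell, hgint.congr hhull, ?_⟩
  have hsum : ∀ x : Fin n → Sphere d, ∑ i, h i x = ((d - k + 1 : ℕ) : ℝ) * g x := fun x =>
    sum_sum_mem_and_isFaceSet _ _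
  rw [← integral_congr_ae hcell, ← integral_congr_ae hhull, hheq]
  simp only [hsum]
  rw [integral_const_mul, Nat.cast_add, Nat.cast_sub hk, Nat.cast_one]
  ring
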